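/- Let $X$ be a connected metrizable space that is strongly countably dimensional, i.e. $X=\bigcup_{n=1}^{\infty}X_n$ for some subsets $X_n\subseteq X$ with $\dim X_n<n$ for every $n\ge 1$, where $\dim$ denotes the Čech–Lebesgue covering dimension ($\dim Y<n$ means that every finite open cover of $Y$ has a finite open refinement covering $Y$ such that each point of $Y$ lies in at most $n$ of its members). Let $(Z_s)_{s\in S}$ be an arbitrary family of metrizable equiconnected spaces, where a space $Z$ is equiconnected if there is a continuous map $\lambda:Z\times Z\times[0,1]\to Z$ with $\lambda(x,y,0)=x$, $\lambda(x,y,1)=y$ and $\lambda(x,x,t)=x$ for all $x,y\in Z$ and $t\in[0,1]$. Let $\Box_{s\in S}Z_s$ be the product $\prod_{s\in S}Z_s$ endowed with the box topology, i.e. the topology generated by all boxes $\prod_{s\in S}G_s$ with every $G_s$ open in $Z_s$. Then for every map $g:X\to\Box_{s\in S}Z_s$ the following conditions are equivalent: (i) $g$ is a Baire-one map, i.e. $g$ is the pointwise limit of a sequence of continuous maps $X\to\Box_{s\in S}Z_s$; (ii) there is a separately continuous map $f:X\times X\to\Box_{s\in S}Z_s$ (continuous in each variable when the other is fixed) with diagonal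 $g$, i.e. $f(x,x)=g(x)$ for all $x\in X$. -/

import Mathlib

open Filter Topology

/-- The box product of a family of topological spaces: the set `∏ s, Z s`, to be endowed with the
box topology. (A type synonym, so that it does not carry the product topology.) -/
def BoxProduct {S : Type*} (Z : S → Type*) : Type _ := ∀ s, Z s

/-- The box topology, generated by all boxes `∏ s, G s` with every `G s` open in `Z s`. -/
instance BoxProduct.instTopologicalSpace {S : Type*} (Z : S → Type*)
    [∀ s, TopologicalSpace (Z s)] : TopologicalSpace (BoxProduct Z) :=
  TopologicalSpace.generateFrom
    {B : Set (∀ s, Z s) | ∃ G : ∀ s, Set (Z s), (∀ s, IsOpen (G s)) ∧ B = Set.univ.pi G}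

/-- The `n`-th Baire class: continuous maps for `n = 0`, and pointwise limits of sequences of maps
of the `n`-th class for `n + 1`. -/
def IsBaireClass {X Y : Type*} [TopologicalSpace X] [TopologicalSpace Y] :
    ℕ → (X → Y) → Prop
  | 0, f => Continuous f
  | n + 1, f => ∃ F : ℕ → X → Y, (∀ k, IsBaireClass n (F k)) ∧
      ∀ x, Tendsto (fun k => F k x) atTop (𝓝 (f x))

/-- Separate continuity of a map of two variables. -/
def SeparatelyContinuous {X Y Z : Type*} [TopologicalSpace X] [TopologicalSpace Y]
    [TopologicalSpace Z] (f : X × Y → Z) : Prop :=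
  (∀ x, Continuous fun y => f (x, y)) ∧ (∀ y, Continuous fun x => f (x, y))

/-- `Z` is equiconnected: there is a continuous `l : Z × Z × [0,1] → Z` with `l (x, y, 0) = x`,
`l (x, y, 1) = y` and `l (x, x, t) = x`. -/
def Equiconnected (Z : Type*) [TopologicalSpace Z] : Prop :=
  ∃ l : Z × Z × unitInterval → Z, Continuous l ∧
    (∀ x y, l (x, y, 0) = x) ∧ (∀ x y, l (y, x, 1) = x) ∧ (∀ x t, l (x, x, t) = x)

/-- `dim Y < n` for the Čech–Lebesgue covering dimension of a normal space `Y`: every finite open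
cover has a finite open refinement covering `Y` such that each point lies in at most `n` of its
members. (For `n = 0` this says that `Y` is empty, i.e. `dim Y = -1`.) -/
def CoveringDimLT (Y : Type*) [TopologicalSpace Y] (n : ℕ) : Prop :=
  ∀ U : Set (Set Y), U.Finite → (∀ u ∈ U, IsOpen u) → ⋃₀ U = Set.univ →
    ∃ V : Set (Set Y), V.Finite ∧ (∀ v ∈ V, IsOpen v) ∧ ⋃₀ V = Set.univ ∧
      (∀ v ∈ V, ∃ u ∈ U, v ⊆ u) ∧ ∀ y : Y, {v ∈ V | y ∈ v}.ncard ≤ n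

/-- `X` is a union of subsets `X₁, X₂, …` with `dim Xₙ < n`; here `A n` is `Xₙ₊₁`. -/
def StronglyCountablyDimensional (X : Type*) [TopologicalSpace X] : Prop :=
  ∃ A : ℕ → Set X, (⋃ n, A n) = Set.univ ∧ ∀ n, CoveringDimLT (A n) (n + 1)

/-!
Two facts about the box topology reduce the theorem to a statement about one equiconnected space.
A continuous map from a connected space into a box product of metrizable spaces takes all its values
in one `σ`-product, the set of points that differ from a given point `a` in finitely many
coordinates (`BoxProduct.finite_ne_of_continuous`); and a `σ`-product of equiconnected spaces is
itself equiconnected in the box topology (`BoxProduct.equiconnected_sigmaProduct`). Convergence in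
the box topology along a countably generated filter is coordinatewise convergence together with
eventual constancy of all but finitely many coordinates
(`BoxProduct.exists_finite_eventually_eq`, `BoxProduct.tendsto_of_eventually_eq`).

Both implications then rest on `exists_continuous_blend`: given maps `q 0, q 1, …` that are
continuous on smaller and smaller open sets, there is a continuous map which at each point is a
combination of just two consecutive ones. If two points converge to `y`, then so do all their
combinations along the equiconnecting map, so that neither local convexity of the target nor a bound
on the order of covers of the domain enters.

* From a separately continuous `f` to a Baire-one diagonal
  (`SeparatelyContinuous.isBaireClass_one_diagonal`): as in Stone's theorem, a metric space is an
  increasing union of closed sets near each of which there is a locally constant map `c` moving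
  points by less than `1 / (k + 1)`. The maps `x ↦ f (c x, x)` for different `k` are blended.
* From a Baire-one `g = lim g k` to a separately continuous `f`
  (`exists_separatelyContinuous_diagonal`): off the diagonal of `X × X`, the maps
  `(x, y) ↦ q k x` are blended in such a way that large `k` are used near the diagonal, and `q k`
  with `k > 0` only where `x` and `y` are so close that `q k x` is close to `q k y`. Here `q k` is `g k` with
  each coordinate pushed to the base point `a` when it is near `a` (`pushTo`), which keeps the
  supports of the values `q k x` under control as `x` tends to `y`
  (`BoxProduct.exists_separatelyContinuous_sigmaProduct`).
-/

/-! ### Convergence in box products -/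

namespace BoxProduct

theorem isOpen_box {S : Type*} {Z : S → Type*} [∀ s, TopologicalSpace (Z s)]
    {G : ∀ s, Set (Z s)} (hG : ∀ s, IsOpen (G s)) :
    IsOpen {z : BoxProduct Z | ∀ s, z s ∈ G s} := by
  refine TopologicalSpace.isOpen_generateFrom_of_mem ⟨G, hG, ?_⟩
  ext z
  exact ⟨fun h s _ => h s, fun h s => h s trivial⟩

theorem continuous_eval {S : Type*} {Z : S → Type*} [∀ s, TopologicalSpace (Z s)] (s : S) :
    Continuous fun z : BoxProduct Z => z s := by
  classical
  refine continuous_def.2 fun U hU => ?_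
  refine TopologicalSpace.isOpen_generateFrom_of_mem
    ⟨Function.update (fun _ => Set.univ) s U, fun i => ?_, ?_⟩
  · rcases eq_or_ne i s with rfl | h
    · simpa using hU
    · simp [h]
  · exact (Set.univ_pi_update_univ s U).symm

/-- Open conditions imposed on pairwise distinct coordinates define an open set. -/
theorem isOpen_setOf_forall_seq {S : Type*} {Z : S → Type*} [∀ s, TopologicalSpace (Z s)]
    {e : ℕ → S} (he : Function.Injective e) {U : ∀ n, Set (Z (e n))} (hU : ∀ n, IsOpen (U n)) :
    IsOpen {z : BoxProduct Z | ∀ n, z (e n) ∈ U n} := by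
  have hG : ∀ s, IsOpen {u : Z s | ∀ n (h : e n = s), h.symm ▸ u ∈ U n} := by
    intro s
    by_cases h : ∃ n, e n = s
    · obtain ⟨n, rfl⟩ := h
      convert hU n using 1
      ext u
      refine ⟨fun h => h n rfl, fun hu m hm => ?_⟩
      obtain rfl := he hm
      exact hu
    · convert isOpen_univ using 1
      ext u
      simp only [Set.mem_ofPred_eq, Set.mem_univ, iff_true]
      exact fun n hn => absurd ⟨n, hn⟩ h
  convert isOpen_box hG using 1
  ext z
  constructor
  · rintro h s n rfl
    exact h n
  · exact fun h n => h (e n) n rfl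

theorem tendsto_of_eventually_eq {α S : Type*} {Z : S → Type*} [∀ s, TopologicalSpace (Z s)]
    {l : Filter α} {h : α → BoxProduct Z} {z : BoxProduct Z} {T : Set S} (hT : T.Finite)
    (heq : ∀ᶠ x in l, ∀ s ∉ T, h x s = z s)
    (hlim : ∀ s, Tendsto (fun x => h x s) l (𝓝 (z s))) : Tendsto h l (𝓝 z) := by
  refine TopologicalSpace.tendsto_nhds_generateFrom_iff.2 ?_
  rintro _ ⟨G, hG, rfl⟩ hz
  have hev : ∀ᶠ x in l, ∀ s ∈ T, h x s ∈ G s :=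
    (eventually_all_finite hT).2 fun s _ => hlim s ((hG s).mem_nhds (hz s trivial))
  filter_upwards [heq, hev] with x h₁ h₂ s _
  by_cases hs : s ∈ T
  · exact h₂ s hs
  · rw [h₁ s hs]
    exact hz s trivial

/-- Convergence in the box topology along a countably generated filter forces all but finitely
many coordinates to be eventually equal to their limits: otherwise points with a wrong coordinate
can be chosen arbitrarily far along the filter, each time in a new coordinate, and the box that
omits these countably many coordinate values is a neighbourhood of the limit that they avoid. -/
theorem exists_finite_eventually_eq {α S : Type*} {Z : S → Type*} [∀ s, TopologicalSpace (Z s)]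
    [∀ s, T1Space (Z s)] {l : Filter α} [l.IsCountablyGenerated] {h : α → BoxProduct Z}
    {z : BoxProduct Z} (hlim : Tendsto h l (𝓝 z)) :
    ∃ T : Set S, T.Finite ∧ ∀ᶠ x in l, ∀ s ∉ T, h x s = z s := by
  classical
  by_contra! hcon
  obtain ⟨b, hb⟩ := l.exists_antitone_basis
  obtain ⟨c, hc, hr⟩ := exists_seq_of_forall_finset_exists
    (fun p : ℕ × α × S => p.2.1 ∈ b p.1 ∧ h p.2.1 p.2.2 ≠ z p.2.2)
    (fun p p' => p.1 < p'.1 ∧ p.2.2 ≠ p'.2.2) (by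
      intro F _
      have h₁ := hcon _ (F.image fun p => p.2.2).finite_toSet
      have h₂ := h₁.and_eventually (hb.mem ((F.sup fun p => p.1) + 1))
      obtain ⟨x, hx, hxb⟩ := h₂.exists
      obtain ⟨s, hs, hxs⟩ := hx
      refine ⟨⟨_, x, s⟩, ⟨hxb, hxs⟩, fun p hp => ⟨?_, ?_⟩⟩
      · exact Nat.lt_succ_of_le (Finset.le_sup (f := fun p : ℕ × α × S => p.1) hp)
      · rintro rfl
        exact hs (Finset.mem_coe.2 (Finset.mem_image_of_mem _ hp)))
  have hinj : Function.Injective fun n => (c n).2.2 := by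
    intro m n hmn
    by_contra hne
    rcases lt_or_gt_of_ne hne with hlt | hlt
    · exact (hr m n hlt).2 hmn
    · exact (hr n m hlt).2 hmn.symm
  have hmono : StrictMono fun n => (c n).1 := fun m n hmn => (hr m n hmn).1
  have hopen := isOpen_setOf_forall_seq hinj
    (U := fun n => {h (c n).2.1 (c n).2.2}ᶜ) fun n => isOpen_compl_singleton
  have hev := hlim (hopen.mem_nhds fun n => (hc n).2.symm)
  obtain ⟨N, -, hN⟩ := hb.1.mem_iff.1 hev
  exact hN (hb.2 (hmono.id_le N) (hc N).1) N rfl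

/-- A connected subset of a box product of metrizable spaces only allows finitely many coordinates
to change: if `z` and `w` differ in the
coordinates `e 0, e 1, …`, then the points `v` with `d(v, z) / d(w, z) → 0` along `e` form a
clopen set that separates `z` from `w`. -/
theorem finite_ne_of_continuous {X S : Type*} {Z : S → Type*} [TopologicalSpace X]
    [PreconnectedSpace X] [∀ s, TopologicalSpace (Z s)]
    [∀ s, TopologicalSpace.MetrizableSpace (Z s)] {h : X → BoxProduct Z} (hh : Continuous h)
    (x y : X) : {s | h x s ≠ h y s}.Finite := by
  let _ : ∀ s, MetricSpace (Z s) := fun s => TopologicalSpace.metrizableSpaceMetric (Z s)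
  by_contra hinf
  have e := Set.Infinite.natEmbedding _ hinf
  let i : ℕ → S := fun n => (e n : S)
  have hi : Function.Injective i := Subtype.val_injective.comp e.injective
  have hne : ∀ n, 0 < dist (h x (i n)) (h y (i n)) := fun n => dist_pos.2 (e n).2
  let K : Set (BoxProduct Z) := {v | Tendsto
    (fun n => dist (v (i n)) (h y (i n)) / dist (h x (i n)) (h y (i n))) atTop (𝓝 0)}
  have hK : ∀ v, ∀ᶠ v' in 𝓝 v, v' ∈ K ↔ v ∈ K := by
    intro v
    have hopen := isOpen_setOf_forall_seq (Z := Z) hi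
      (U := fun n => Metric.ball (v (i n)) (dist (h x (i n)) (h y (i n)) / (n + 1)))
      fun n => Metric.isOpen_ball
    filter_upwards [hopen.mem_nhds fun n =>
      Metric.mem_ball_self (div_pos (hne n) n.cast_add_one_pos)] with v' hv'
    have hd : Tendsto (fun n => dist (v' (i n)) (h y (i n)) / dist (h x (i n)) (h y (i n)) -
        dist (v (i n)) (h y (i n)) / dist (h x (i n)) (h y (i n))) atTop (𝓝 0) := by
      refine squeeze_zero_norm (fun n => ?_) tendsto_one_div_add_atTop_nhds_zero_nat
      rw [← sub_div, norm_div, Real.norm_of_nonneg (hne n).le, div_le_iff₀ (hne n),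
        one_div_mul_eq_div]
      exact (abs_dist_sub_le _ _ _).trans (hv' n).le
    constructor
    · intro hv
      have := Tendsto.sub hv hd
      simpa [K] using this
    · intro hv
      have := Tendsto.add hv hd
      simpa [K] using this
  have hclopen : IsClopen K := by
    refine ⟨⟨isOpen_iff_mem_nhds.2 fun v hv => ?_⟩, isOpen_iff_mem_nhds.2 fun v hv => ?_⟩
    · filter_upwards [hK v] with v' h' using fun h'' => hv (h'.1 h'')
    · filter_upwards [hK v] with v' h' using h'.2 hv
  have hy : y ∈ h ⁻¹' K := by simp [K]
  have hx : x ∈ h ⁻¹' K := by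
    rw [(hclopen.preimage hh).eq_univ ⟨y, hy⟩]
    trivial
  have hx' : Tendsto (fun _ : ℕ => (1 : ℝ)) atTop (𝓝 0) := by
    refine Tendsto.congr (fun n => ?_) (show Tendsto _ _ _ from hx)
    exact div_self (hne n).ne'
  exact one_ne_zero (tendsto_nhds_unique tendsto_const_nhds hx')

/-- The points of the box product that differ from `a` in finitely many coordinates only. -/
def sigmaProduct {S : Type*} {Z : S → Type*} (a : BoxProduct Z) : Set (BoxProduct Z) :=
  {z | {s | z s ≠ a s}.Finite}

end BoxProduct

/-! ### Equiconnected spaces -/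

/-- The tube lemma for an equiconnecting map along its constant paths. -/
theorem exists_nhds_equiconnecting_mem {Y : Type*} [TopologicalSpace Y]
    {l : Y × Y × unitInterval → Y} (hl : Continuous l) (hd : ∀ y t, l (y, y, t) = y)
    {y : Y} {G : Set Y} (hG : G ∈ 𝓝 y) :
    ∃ A : Set Y, IsOpen A ∧ y ∈ A ∧ ∀ u ∈ A, ∀ v ∈ A, ∀ t, l (u, v, t) ∈ G := by
  have h : ∀ᶠ p in 𝓝 (y, y), ∀ t ∈ (Set.univ : Set unitInterval), l (p.1, p.2, t) ∈ G := by
    refine isCompact_univ.eventually_forall_of_forall_eventually fun t _ => ?_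
    have hc : Continuous fun q : (Y × Y) × unitInterval => l (q.1.1, q.1.2, q.2) := by fun_prop
    refine hc.continuousAt.eventually_mem ?_
    simpa [hd] using hG
  rw [nhds_prod_eq, eventually_prod_self_iff'] at h
  obtain ⟨t, ht, h⟩ := h
  obtain ⟨A, hAt, hA, hy⟩ := mem_nhds_iff.1 ht
  exact ⟨A, hA, hy, fun u hu v hv s => h u (hAt hu) v (hAt hv) s trivial⟩

/-- The coordinatewise equiconnecting map is continuous in the box topology once infinitely many
simultaneous restrictions on the parameter `t` are avoided. On a `σ`-product this is so: in all
but finitely many coordinates both end points equal `a s`, and the tube lemma gives a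
neighbourhood that works for all `t`. -/
theorem BoxProduct.equiconnected_sigmaProduct {S : Type*} {Z : S → Type*}
    [∀ s, TopologicalSpace (Z s)] (hZ : ∀ s, Equiconnected (Z s)) (a : BoxProduct Z) :
    Equiconnected (sigmaProduct a) := by
  choose l hl h0 h1 hd using hZ
  let L : BoxProduct Z → BoxProduct Z → unitInterval → BoxProduct Z :=
    fun x y t s => l s (x s, y s, t)
  have hL : ∀ x ∈ sigmaProduct a, ∀ y ∈ sigmaProduct a, ∀ t, L x y t ∈ sigmaProduct a := by
    intro x hx y hy t
    refine (Set.Finite.union hx hy).subset fun s hs => ?_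
    by_contra hxy
    simp only [Set.mem_union, Set.mem_ofPred_eq, not_or, not_not] at hxy
    exact hs (by simp [L, hxy.1, hxy.2, hd])
  refine ⟨fun p => ⟨L p.1 p.2.1 p.2.2, hL _ p.1.2 _ p.2.1.2 _⟩, ?_, ?_, ?_, ?_⟩
  · refine Continuous.subtype_mk (continuous_generateFrom_iff.2 ?_) _
    rintro _ ⟨G, hG, rfl⟩
    refine isOpen_iff_mem_nhds.2 ?_
    rintro ⟨x, y, t⟩ hxyt
    have hT : ({s | x.1 s ≠ a s} ∪ {s | y.1 s ≠ a s}).Finite := x.2.union y.2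
    set T := {s | x.1 s ≠ a s} ∪ {s | y.1 s ≠ a s}
    have key : ∀ s, ∃ (A B : Set (Z s)) (J : Set unitInterval), IsOpen A ∧ IsOpen B ∧
        J ∈ 𝓝 t ∧ (s ∉ T → J = Set.univ) ∧ x.1 s ∈ A ∧ y.1 s ∈ B ∧
        ∀ u ∈ A, ∀ v ∈ B, ∀ r ∈ J, l s (u, v, r) ∈ G s := by
      intro s
      have hs : G s ∈ 𝓝 (l s (x.1 s, y.1 s, t)) := (hG s).mem_nhds (hxyt s trivial)
      by_cases hsT : s ∈ T
      · have hpre := (hl s).continuousAt.preimage_mem_nhds hs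
        obtain ⟨A, B', hA, hxA, hB', hyB', hAB⟩ := mem_nhds_prod_iff'.1 hpre
        obtain ⟨B, J, hB, hyB, hJ, htJ, hBJ⟩ := mem_nhds_prod_iff'.1 (hB'.mem_nhds hyB')
        exact ⟨A, B, J, hA, hB, hJ.mem_nhds htJ, fun h => absurd hsT h, hxA, hyB,
          fun u hu v hv r hr => hAB (Set.mk_mem_prod hu (hBJ (Set.mk_mem_prod hv hr)))⟩
      · have hxy : x.1 s = a s ∧ y.1 s = a s := by
          simpa only [T, Set.mem_union, Set.mem_ofPred_eq, not_or, not_not] using hsT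
        rw [hxy.1, hxy.2, hd] at hs
        obtain ⟨A, hA, haA, hAG⟩ := exists_nhds_equiconnecting_mem (hl s) (hd s) hs
        exact ⟨A, A, Set.univ, hA, hA, univ_mem, fun _ => rfl, hxy.1 ▸ haA, hxy.2 ▸ haA,
          fun u hu v hv r _ => hAG u hu v hv r⟩
    choose A B J hA hB hJ hJT hxA hyB hABJ using key
    have e₁ : ∀ᶠ x' : sigmaProduct a in 𝓝 x, ∀ s, x'.1 s ∈ A s :=
      continuous_subtype_val.continuousAt.preimage_mem_nhds ((isOpen_box hA).mem_nhds hxA)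
    have e₂ : ∀ᶠ y' : sigmaProduct a in 𝓝 y, ∀ s, y'.1 s ∈ B s :=
      continuous_subtype_val.continuousAt.preimage_mem_nhds ((isOpen_box hB).mem_nhds hyB)
    have e₃ : ∀ᶠ r in 𝓝 t, ∀ s ∈ T, r ∈ J s := (eventually_all_finite hT).2 fun s _ => hJ s
    rw [nhds_prod_eq, nhds_prod_eq]
    filter_upwards [e₁.prod_mk (e₂.prod_mk e₃)]
    rintro ⟨x', y', r⟩ ⟨h₁, h₂, h₃⟩ s -
    refine hABJ s _ (h₁ s) _ (h₂ s) r ?_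
    by_cases hsT : s ∈ T
    · exact h₃ s hsT
    · rw [hJT s hsT]
      trivial
  · exact fun x y => Subtype.ext (funext fun s => h0 s _ _)
  · exact fun x y => Subtype.ext (funext fun s => h1 s _ _)
  · exact fun x t => Subtype.ext (funext fun s => hd s _ _)

/-! ### Blending a sequence of partially defined maps -/

/-- A sum of Urysohn functions that counts how deep a point lies in the sequence `V`. -/
theorem exists_continuous_depth {T : Type*} [TopologicalSpace T] [NormalSpace T]
    {V C : ℕ → Set T} (hV : ∀ k, IsOpen (V k)) (hanti : Antitone V) (hfin : LocallyFinite V)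
    (hC : ∀ k, IsClosed (C k)) (hCV : ∀ k, C k ⊆ V k) :
    ∃ τ : T → ℝ, Continuous τ ∧ (∀ x, 0 ≤ τ x) ∧ (∀ (k : ℕ) x, (k : ℝ) < τ x → x ∈ V k) ∧
      ∀ (m : ℕ) x, (∀ k < m, x ∈ C k) → (m : ℝ) ≤ τ x := by
  have hU : ∀ k, ∃ θ : C(T, ℝ), Set.EqOn θ 0 (V k)ᶜ ∧ Set.EqOn θ 1 (C k) ∧
      ∀ x, θ x ∈ Set.Icc (0 : ℝ) 1 := fun k =>
    exists_continuous_zero_one_of_isClosed (hV k).isClosed_compl (hC k)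
      (Set.disjoint_left.2 fun x hx hx' => hx (hCV k hx'))
  choose θ h0 h1 hI using hU
  have hsupp : ∀ k, Function.support (θ k) ⊆ V k := fun k x hx => by
    by_contra hxV
    exact hx (h0 k hxV)
  have hsum : ∀ (K : ℕ) x, x ∉ V K → ∑ᶠ k, θ k x = ∑ k ∈ Finset.range K, θ k x := by
    intro K x hx
    refine finsum_eq_sum_of_support_subset _ fun k hk => ?_
    have hkV : x ∈ V k := hsupp k hk
    simp only [Finset.coe_range, Set.mem_Iio]
    by_contra! hKk
    exact hx (hanti hKk hkV)
  refine ⟨fun x => ∑ᶠ k, θ k x, continuous_finsum (fun k => (θ k).continuous)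
    (hfin.subset hsupp), fun x => finsum_nonneg fun k => (hI k x).1, fun k x hk => ?_,
    fun m x hm => ?_⟩
  · by_contra hx
    refine absurd hk (not_lt.2 ?_)
    simp only [hsum k x hx]
    calc ∑ i ∈ Finset.range k, θ i x ≤ ∑ i ∈ Finset.range k, 1 :=
          Finset.sum_le_sum fun i _ => (hI i x).2
      _ = k := by simp
  · obtain ⟨K, hK⟩ : ∃ K, x ∉ V K := by
      by_contra! hall
      have := hfin.point_finite x
      exact Set.infinite_univ (this.subset fun k _ => hall k)
    have hmK : m ≤ K := by
      by_contra! hlt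
      exact hK (hCV K (hm K hlt))
    simp only [hsum K x hK]
    calc (m : ℝ) = ∑ i ∈ Finset.range m, θ i x := by
          rw [Finset.sum_congr rfl fun i hi => h1 i (hm i (Finset.mem_range.1 hi))]
          simp
      _ ≤ ∑ i ∈ Finset.range K, θ i x :=
          Finset.sum_le_sum_of_subset_of_nonneg (Finset.range_mono hmK) fun i _ _ => (hI i x).1

/-- Running through the points `Q 0 x, Q 1 x, …` of an equiconnected space along the paths given
by `l`, with a continuous time `τ x`, is continuous in `x`. The map `Q k` enters as soon as
`τ x` exceeds `k - 1`; the hypothesis asks for a margin of one more unit. -/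
theorem continuous_polygonal {T Y : Type*} [TopologicalSpace T] [TopologicalSpace Y]
    {l : Y × Y × unitInterval → Y} (hl : Continuous l) (h0 : ∀ x y, l (x, y, 0) = x)
    (h1 : ∀ x y, l (y, x, 1) = x) {τ : T → ℝ} (hτ : Continuous τ) (hτ0 : ∀ x, 0 ≤ τ x)
    {Q : ℕ → T → Y} (hQ : ∀ (k : ℕ) x, (k : ℝ) < τ x + 2 → ContinuousAt (Q k) x) :
    Continuous fun x => l (Q ⌊τ x⌋₊ x, Q (⌊τ x⌋₊ + 1) x,
      Set.projIcc 0 1 zero_le_one (τ x - ⌊τ x⌋₊)) := by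
  set p : T → Y := fun x => l (Q ⌊τ x⌋₊ x, Q (⌊τ x⌋₊ + 1) x,
      Set.projIcc 0 1 zero_le_one (τ x - ⌊τ x⌋₊)) with hp
  let A : ℕ → T → Y := fun n x => l (Q n x, Q (n + 1) x, Set.projIcc 0 1 zero_le_one (τ x - n))
  have hA : ∀ (n : ℕ) x, (n : ℝ) ≤ τ x → τ x ≤ n + 1 → p x = A n x := by
    intro n x h₁ h₂
    rcases h₂.lt_or_eq with h₂ | h₂
    · have : ⌊τ x⌋₊ = n := (Nat.floor_eq_iff (hτ0 x)).2 ⟨h₁, h₂⟩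
      simp only [hp, A, this]
    · have : ⌊τ x⌋₊ = n + 1 := by
        rw [h₂]
        exact_mod_cast Nat.floor_natCast (n + 1)
      have e₁ : τ x - ((n + 1 : ℕ) : ℝ) = 0 := by rw [h₂]; push_cast; ring
      have e₂ : τ x - (n : ℝ) = 1 := by rw [h₂]; ring
      simp only [hp, A, this, e₁, e₂, Set.projIcc_left, Set.projIcc_right]
      exact (h0 _ _).trans (h1 _ _).symm
  have hAc : ∀ (n : ℕ) x, (n : ℝ) ≤ τ x → ContinuousAt (A n) x := by
    intro n x hn
    have c₁ := hQ n x (by linarith)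
    have c₂ := hQ (n + 1) x (by push_cast; linarith)
    have c₃ : ContinuousAt (fun x => Set.projIcc (0 : ℝ) 1 zero_le_one (τ x - n)) x :=
      (continuous_projIcc.comp (hτ.sub continuous_const)).continuousAt
    exact hl.continuousAt.comp (c₁.prodMk (c₂.prodMk c₃))
  refine continuous_iff_continuousAt.2 fun x => ?_
  have hn₁ : (⌊τ x⌋₊ : ℝ) ≤ τ x := Nat.floor_le (hτ0 x)
  have hn₂ : τ x < ⌊τ x⌋₊ + 1 := Nat.lt_floor_add_one _
  set n := ⌊τ x⌋₊
  have hup : ∀ᶠ y in 𝓝 x, τ y < n + 1 := hτ.continuousAt.eventually_lt_const hn₂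
  have hR : Tendsto (A n) (𝓝 x) (𝓝 (p x)) := by
    rw [hA n x hn₁ hn₂.le]
    exact hAc n x hn₁
  intro G hG
  change ∀ᶠ y in 𝓝 x, p y ∈ G
  rcases hn₁.lt_or_eq with hlt | heq
  · filter_upwards [hup, hτ.continuousAt.eventually_const_lt hlt, hR hG] with y h₁ h₂ h₃
    rw [hA n y h₂.le h₁.le]
    exact h₃
  · rcases hnz : n with _ | m
    · filter_upwards [hup, hR hG] with y h₁ h₃
      rw [hA n y (by rw [hnz]; simpa using hτ0 y) h₁.le]
      exact h₃
    · have hnm : (n : ℝ) = m + 1 := by rw [hnz]; push_cast; ring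
      have hL : Tendsto (A m) (𝓝 x) (𝓝 (p x)) := by
        rw [hA m x (by linarith) (by linarith)]
        exact hAc m x (by linarith)
      have hlow : ∀ᶠ y in 𝓝 x, (m : ℝ) < τ y :=
        hτ.continuousAt.eventually_const_lt (by linarith)
      filter_upwards [hup, hlow, hR hG, hL hG] with y h₁ h₂ h₃ h₄
      rcases le_total (n : ℝ) (τ y) with h | h
      · rw [hA n y h h₁.le]
        exact h₃
      · rw [hA m y h₂.le (by linarith)]
        exact h₄

/-- Maps `q k`, continuous on decreasing open sets `V k`, can be blended into one continuous map
that at each point is a combination of only two consecutive `q i`, with `i` large at the points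
that lie in many of the closed sets `C k`. Having only two terms is what makes equiconnectedness
sufficient: no bound on the order of a cover is needed. -/
theorem exists_continuous_blend {T Y : Type*} [TopologicalSpace T] [NormalSpace T]
    [TopologicalSpace Y] {l : Y × Y × unitInterval → Y} (hl : Continuous l)
    (h0 : ∀ x y, l (x, y, 0) = x) (h1 : ∀ x y, l (y, x, 1) = x)
    {V C : ℕ → Set T} (hV : ∀ k, IsOpen (V k)) (hanti : Antitone V) (hfin : LocallyFinite V)
    (hC : ∀ k, IsClosed (C k)) (hCV : ∀ k, C k ⊆ V k) {b : T → Y} (hb : Continuous b)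
    {q : ℕ → T → Y} (hq : ∀ k, ∀ x ∈ V k, ContinuousAt (q k) x) :
    ∃ p : T → Y, Continuous p ∧ ∀ m x, (∀ k < m + 2, x ∈ C k) →
      ∃ i ≥ m, x ∈ V (i + 1) ∧ ∃ t, p x = l (q i x, q (i + 1) x, t) := by
  obtain ⟨τ, hτ, hτ0, hτV, hτC⟩ := exists_continuous_depth hV hanti hfin hC hCV
  -- The shift by two provides the margin required by `continuous_polygonal`.
  let Q : ℕ → T → Y := fun k => if k < 2 then b else q (k - 2)
  have hQ : ∀ (k : ℕ) x, (k : ℝ) < τ x + 2 → ContinuousAt (Q k) x := by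
    intro k x hk
    by_cases h2 : k < 2
    · simp only [Q, h2, if_true]
      exact hb.continuousAt
    · simp only [Q, h2, if_false]
      refine hq _ _ (hτV _ _ ?_)
      rw [Nat.cast_sub (not_lt.1 h2)]
      push_cast
      linarith
  refine ⟨_, continuous_polygonal hl h0 h1 hτ hτ0 hQ, fun m x hx => ?_⟩
  have hfl : m + 2 ≤ ⌊τ x⌋₊ := Nat.le_floor (hτC _ _ hx)
  obtain ⟨j, hj⟩ := Nat.exists_eq_add_of_le hfl
  have hle : (⌊τ x⌋₊ : ℝ) ≤ τ x := Nat.floor_le (hτ0 x)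
  refine ⟨m + j, Nat.le_add_right _ _, hτV _ _ ?_,
    Set.projIcc 0 1 zero_le_one (τ x - ⌊τ x⌋₊), ?_⟩
  · rw [hj] at hle
    push_cast at hle ⊢
    linarith
  · have e₁ : Q ⌊τ x⌋₊ = q (m + j) := by
      have : ¬ ⌊τ x⌋₊ < 2 := by omega
      simp only [Q, this, if_false]
      congr 1
      omega
    have e₂ : Q (⌊τ x⌋₊ + 1) = q (m + j + 1) := by
      have : ¬ ⌊τ x⌋₊ + 1 < 2 := by omega
      simp only [Q, this, if_false]
      congr 1
      omega
    rw [e₁, e₂]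

/-! ### Diagonals of separately continuous maps are Baire-one -/

/-- A countable form of Stone's theorem. Every point `x` has a first point `j x`, in a fixed
well-ordering, at distance less than `r`. Among the points `x` such that the ball of radius `ε`
around `x` is contained in the ball of radius `r` around `j x`, those with different `j x` are at
distance at least `ε`, so that `j` extends to a locally constant map near these points. -/
theorem exists_locallyConstant_selection {X : Type*} [MetricSpace X] {r : ℝ} (hr : 0 < r) :
    ∃ (D V : ℕ → Set X) (c : ℕ → X → X), (∀ n, IsClosed (D n)) ∧ Monotone D ∧
      (∀ x, ∃ n, x ∈ D n) ∧ (∀ n, IsOpen (V n)) ∧ (∀ n, D n ⊆ V n) ∧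
      (∀ n, ∀ x ∈ V n, dist (c n x) x < r) ∧
      ∀ n, ∀ x ∈ V n, ∀ᶠ y in 𝓝 x, c n y = c n x := by
  have hj : ∀ x : X, ∃ j, dist x j < r ∧ ∀ i, WellOrderingRel i j → ¬ dist x i < r := by
    intro x
    have hne : {j | dist x j < r}.Nonempty := ⟨x, by simpa using hr⟩
    have wf : WellFounded (WellOrderingRel : X → X → Prop) := IsWellFounded.wf
    exact ⟨wf.min _ hne, wf.min_mem _ hne, fun i hi hxi => wf.not_lt_min _ hxi hi⟩
  choose j hjr hjmin using hj
  let ε : ℕ → ℝ := fun n => 1 / ((n : ℝ) + 1)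
  have hε : ∀ n, 0 < ε n := fun n => Nat.one_div_pos_of_nat
  let E : ℕ → Set X := fun n => {x | Metric.ball x (ε n) ⊆ Metric.ball (j x) r}
  have hsep : ∀ n, ∀ x ∈ E n, ∀ y ∈ E n, dist x y < ε n → j x = j y := by
    have aux : ∀ n, ∀ x ∈ E n, ∀ y, dist x y < ε n → ¬ WellOrderingRel (j x) (j y) := by
      intro n x hx y hxy hlt
      exact hjmin y _ hlt (hx (by rwa [Metric.mem_ball, dist_comm]))
    intro n x hx y hy hxy
    rcases trichotomous_of WellOrderingRel (j x) (j y) with h | h | h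
    · exact absurd h (aux n x hx y hxy)
    · exact h
    · exact absurd h (aux n y hy x (by rwa [dist_comm]))
  have hch : ∀ n x, ∃ y, x ∈ Metric.thickening (ε n / 3) (E n) → y ∈ E n ∧ dist x y < ε n / 3 := by
    intro n x
    by_cases hx : x ∈ Metric.thickening (ε n / 3) (E n)
    · obtain ⟨y, hy, hxy⟩ := Metric.mem_thickening_iff.1 hx
      exact ⟨y, fun _ => ⟨hy, hxy⟩⟩
    · exact ⟨x, fun h => absurd h hx⟩
  choose y hy using hch
  refine ⟨fun n => closure (E n), fun n => Metric.thickening (ε n / 3) (E n),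
    fun n x => j (y n x), fun n => isClosed_closure, fun m n hmn => closure_mono ?_, fun x => ?_,
    fun n => Metric.isOpen_thickening,
    fun n => Metric.closure_subset_thickening (by linarith [hε n]) _, fun n x hx => ?_,
    fun n x hx => ?_⟩
  · exact fun x hx => (Metric.ball_subset_ball (Nat.one_div_le_one_div hmn)).trans hx
  · obtain ⟨δ, hδ, hball⟩ := Metric.isOpen_iff.1 (Metric.isOpen_ball (x := j x) (ε := r)) x (hjr x)
    obtain ⟨n, hn⟩ := exists_nat_one_div_lt hδ
    exact ⟨n, subset_closure ((Metric.ball_subset_ball hn.le).trans hball)⟩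
  · obtain ⟨h₁, h₂⟩ := hy n x hx
    rw [dist_comm]
    exact h₁ (Metric.mem_ball.2 (by linarith [hε n]))
  · filter_upwards [Metric.isOpen_thickening.mem_nhds hx,
      Metric.ball_mem_nhds x (show 0 < ε n / 3 by linarith [hε n])] with z hz hzx
    obtain ⟨h₁, h₂⟩ := hy n x hx
    obtain ⟨h₃, h₄⟩ := hy n z hz
    refine hsep n _ h₃ _ h₁ ?_
    have t₁ := dist_triangle4 (y n z) z x (y n x)
    rw [dist_comm (y n z) z] at t₁
    have := Metric.mem_ball.1 hzx
    linarith

/-- The approximations blend the maps `x ↦ f (c k x, x)`, where the locally constant selection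
`c k` moves points by less than `1 / (k + 1)`. -/
theorem SeparatelyContinuous.isBaireClass_one_diagonal {X Y : Type*} [TopologicalSpace X]
    [TopologicalSpace.MetrizableSpace X] [TopologicalSpace Y] (hY : Equiconnected Y)
    {f : X × X → Y} (hf : SeparatelyContinuous f) : IsBaireClass 1 fun x => f (x, x) := by
  let _ : MetricSpace X := TopologicalSpace.metrizableSpaceMetric X
  rcases isEmpty_or_nonempty X with hX | ⟨⟨x₀⟩⟩
  · exact ⟨fun _ x => f (x, x), fun _ => continuous_of_discreteTopology, fun x => (hX.false x).elim⟩
  obtain ⟨l, hl, h0, h1, hd⟩ := hY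
  choose D V c hD hmono hex hV hDV hcr hc using fun k : ℕ =>
    exists_locallyConstant_selection (X := X) (Nat.one_div_pos_of_nat (n := k) (α := ℝ))
  have hp : ∀ n : ℕ, ∃ p : X → Y, Continuous p ∧ ∀ m x,
      (∀ k < m + 2, x ∈ {x | k ≤ n ∧ ∀ i ≤ k, x ∈ D i n}) →
      ∃ i ≥ m, x ∈ {x | i + 1 ≤ n ∧ ∀ i' ≤ i + 1, x ∈ V i' n} ∧
        ∃ t, p x = l (f (c i n x, x), f (c (i + 1) n x, x), t) := by
    intro n
    refine exists_continuous_blend hl h0 h1 (V := fun k => {x | k ≤ n ∧ ∀ i ≤ k, x ∈ V i n})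
      (C := fun k => {x | k ≤ n ∧ ∀ i ≤ k, x ∈ D i n}) (fun k => ?_) (fun k k' hk x hx => ?_) ?_
      (fun k => ?_) (fun k x hx => ?_) (hf.1 x₀) (q := fun k x => f (c k n x, x)) fun k x hx => ?_
    · refine isOpen_const.and ?_
      simp only [Set.ofPred_forall]
      exact (Set.finite_Iic k).isOpen_biInter fun i _ => hV i n
    · exact ⟨hk.trans hx.1, fun i hi => hx.2 i (hi.trans hk)⟩
    · refine fun x => ⟨Set.univ, univ_mem, (Set.finite_Iic n).subset ?_⟩
      rintro k ⟨x, hx, -⟩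
      exact hx.1
    · refine isClosed_const.and ?_
      simp only [Set.ofPred_forall]
      exact isClosed_biInter fun i _ => hD i n
    · exact ⟨hx.1, fun i hi => hDV i n (hx.2 i hi)⟩
    · refine (hf.1 (c k n x)).continuousAt.congr ?_
      filter_upwards [hc k n x (hx.2 k le_rfl)] with y hy
      rw [hy]
  choose p hpc hp using hp
  refine ⟨p, hpc, fun x => ?_⟩
  intro G hG
  obtain ⟨A, hA, hxA, hAG⟩ := exists_nhds_equiconnecting_mem hl hd hG
  obtain ⟨δ, hδ, hball⟩ := Metric.mem_nhds_iff.1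
    ((hf.2 x).continuousAt.preimage_mem_nhds (hA.mem_nhds hxA))
  obtain ⟨m, hm⟩ := exists_nat_one_div_lt hδ
  have hev : ∀ᶠ n in atTop, ∀ i ∈ Set.Iio (m + 2), x ∈ D i n := by
    refine (eventually_all_finite (Set.finite_Iio _)).2 fun i _ => ?_
    obtain ⟨n, hn⟩ := hex i x
    filter_upwards [eventually_ge_atTop n] with n' hn' using hmono i hn' hn
  change ∀ᶠ n in atTop, p n x ∈ G
  filter_upwards [hev, eventually_ge_atTop (m + 2)] with n hn hmn
  obtain ⟨i, him, ⟨-, hxV⟩, t, ht⟩ := hp n m x fun k hk =>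
    ⟨hk.le.trans hmn, fun i hi => hn i (lt_of_le_of_lt hi hk)⟩
  have hclose : ∀ i' ≥ m, x ∈ V i' n → f (c i' n x, x) ∈ A := by
    intro i' hi' hx
    refine hball (Metric.mem_ball.2 ((hcr i' n x hx).trans_le ?_))
    exact (Nat.one_div_le_one_div hi').trans hm.le
  rw [ht]
  exact hAG _ (hclose i him (hxV i i.le_succ)) _
    (hclose (i + 1) (him.trans i.le_succ) (hxV _ le_rfl)) t

/-! ### Separately continuous maps with prescribed diagonal -/

/-- A map `g` is the diagonal of a separately continuous map as soon as there are continuous maps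
`q k` and neighbourhoods `W k` of the diagonal of `X × X` with `q k x → g y` as `k → ∞` and
`(x, y) ∈ W k`. Off the diagonal, the `q k x` are blended so that at `(x, y)` an index `k > 0` is
used only if `(x, y) ∈ W k`; the indices used tend to infinity at the diagonal. -/
theorem exists_separatelyContinuous_diagonal {X Y : Type*} [TopologicalSpace X]
    [TopologicalSpace.MetrizableSpace X] [TopologicalSpace Y] (hY : Equiconnected Y)
    {g : X → Y} {q : ℕ → X → Y} (hq : ∀ k, Continuous (q k)) {W : ℕ → Set (X × X)}
    (hW : ∀ k, IsOpen (W k)) (hWd : ∀ k x, (x, x) ∈ W k)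
    (hg : ∀ y, ∀ G ∈ 𝓝 (g y), ∃ m, ∀ k ≥ m, ∀ x, (x, y) ∈ W k → q k x ∈ G) :
    ∃ f : X × X → Y, SeparatelyContinuous f ∧ ∀ x, f (x, x) = g x := by
  classical
  let _ : MetricSpace X := TopologicalSpace.metrizableSpaceMetric X
  obtain ⟨l, hl, h0, h1, hd⟩ := hY
  have hN : ∀ k : ℕ, ∃ N : Set (X × X), IsOpen N ∧ Set.diagonal X ⊆ N ∧
      closure N ⊆ W k ∩ {p | dist p.1 p.2 < 1 / ((k : ℝ) + 1)} := by
    intro k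
    refine normal_exists_closure_subset isClosed_diagonal
      ((hW k).inter (isOpen_lt (by fun_prop) continuous_const)) ?_
    rintro ⟨x, y⟩ (hxy : x = y)
    subst hxy
    refine ⟨hWd k x, ?_⟩
    simpa using k.cast_add_one_pos
  choose N hNo hNd hNW using hN
  let T : Set (X × X) := (Set.diagonal X)ᶜ
  have hT : IsOpen T := isClosed_diagonal.isOpen_compl
  obtain ⟨p, hp, hpq⟩ : ∃ p : T → Y, Continuous p ∧
      ∀ m x, (∀ k < m + 2, x ∈ {x : T | ∀ i ≤ k, x.1 ∈ closure (N i)}) →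
      ∃ i ≥ m, x ∈ {x : T | ∀ i' ≤ i + 1, x.1 ∈ W i' ∩ {p | dist p.1 p.2 < 1 / ((i' : ℝ) + 1)}} ∧
        ∃ t, p x = l (q i x.1.1, q (i + 1) x.1.1, t) := by
    refine exists_continuous_blend hl h0 h1 (T := T)
      (V := fun k => {x : T | ∀ i ≤ k, x.1 ∈ W i ∩ {p | dist p.1 p.2 < 1 / ((i : ℝ) + 1)}})
      (C := fun k => {x : T | ∀ i ≤ k, x.1 ∈ closure (N i)})
      (fun k => ?_) (fun k k' hk x hx i hi => hx i (hi.trans hk)) ?_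
      (fun k => ?_) (fun k x hx i hi => hNW i (hx i hi)) (b := fun x => q 0 x.1.1)
      ((hq 0).comp (by fun_prop)) (q := fun k x => q k x.1.1)
      fun k x _ => ((hq k).comp (by fun_prop)).continuousAt
    · simp only [Set.ofPred_forall]
      refine (Set.finite_Iic k).isOpen_biInter fun i _ => ?_
      exact ((hW i).inter (isOpen_lt (by fun_prop) continuous_const)).preimage
        continuous_subtype_val
    · rintro ⟨⟨x, y⟩, hxy⟩
      have hpos : 0 < dist x y := dist_pos.2 hxy
      obtain ⟨K, hK⟩ := exists_nat_one_div_lt (half_pos hpos)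
      refine ⟨{z : T | dist x y / 2 < dist z.1.1 z.1.2},
        (isOpen_lt continuous_const (by fun_prop)).mem_nhds (half_lt_self hpos),
        (Set.finite_Iio K).subset ?_⟩
      rintro k ⟨z, hz, hz'⟩
      simp only [Set.mem_Iio]
      by_contra! hKk
      have h₁ : dist z.1.1 z.1.2 < 1 / ((k : ℝ) + 1) := (hz k le_rfl).2
      have h₂ : (1 : ℝ) / (k + 1) ≤ 1 / (K + 1) := Nat.one_div_le_one_div hKk
      have h₃ : dist x y / 2 < dist z.1.1 z.1.2 := hz'
      linarith
    · simp only [Set.ofPred_forall]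
      exact isClosed_biInter fun i _ => isClosed_closure.preimage continuous_subtype_val
  let f : X × X → Y := fun z => if h : z ∈ T then p ⟨z, h⟩ else g z.1
  have hfd : ∀ x, f (x, x) = g x := fun x => dif_neg fun h => h rfl
  have hfT : ∀ z (h : z ∈ T), f z = p ⟨z, h⟩ := fun z h => dif_pos h
  have hoff : ∀ z ∈ T, ContinuousAt f z := by
    intro z hz
    refine (hT.isOpenEmbedding_subtypeVal.continuousAt_iff (x := ⟨z, hz⟩)).1 ?_
    refine hp.continuousAt.congr (Eventually.of_forall fun w => ?_)
    exact (hfT w.1 w.2).symm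
  -- Near `(z, z)`, the map `f` is close to `g z` on the cross formed by the lines through `(z, z)`.
  have hcross : ∀ z, ∀ G ∈ 𝓝 (g z), ∀ᶠ w : X × X in 𝓝 (z, z), w.1 = z ∨ w.2 = z → f w ∈ G := by
    intro z G hG
    obtain ⟨A, hA, hzA, hAG⟩ := exists_nhds_equiconnecting_mem hl hd hG
    obtain ⟨m, hm⟩ := hg z A (hA.mem_nhds hzA)
    have hev : ∀ᶠ w : X × X in 𝓝 (z, z), ∀ i ∈ Set.Iio (m + 2), w ∈ N i :=
      (eventually_all_finite (Set.finite_Iio _)).2 fun i _ => (hNo i).mem_nhds (hNd i rfl)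
    filter_upwards [hev] with w hw hwz
    by_cases hwT : w ∈ T
    · obtain ⟨i, him, hV, t, ht⟩ := hpq m ⟨w, hwT⟩ fun k hk i hi =>
        subset_closure (hw i (lt_of_le_of_lt hi hk))
      have hqA : ∀ i' ≥ m, i' ≤ i + 1 → q i' w.1 ∈ A := by
        intro i' h₁ h₂
        rcases hwz with h | h
        · rw [h]
          exact hm i' h₁ z (hWd i' z)
        · refine hm i' h₁ w.1 ?_
          rw [← h]
          exact (hV i' h₂).1
      rw [hfT w hwT, ht]
      exact hAG _ (hqA i him i.le_succ) _ (hqA (i + 1) (him.trans i.le_succ) le_rfl) t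
    · have hw12 : w.1 = w.2 := not_not.1 hwT
      have hwzz : w = (z, z) := by
        rcases hwz with h | h
        · exact Prod.ext h (hw12 ▸ h)
        · exact Prod.ext (hw12.trans h) h
      rw [hwzz, hfd]
      exact mem_of_mem_nhds hG
  refine ⟨f, ⟨fun x => ?_, fun y => ?_⟩, hfd⟩
  · refine continuous_iff_continuousAt.2 fun y => ?_
    have hc : ContinuousAt (fun y => (x, y)) y := by fun_prop
    by_cases hxy : x = y
    · subst hxy
      intro G hG
      simp only [hfd] at hG
      change ∀ᶠ w in 𝓝 x, _ ∈ G
      filter_upwards [hc.eventually (hcross x G hG)] with w hw using hw (Or.inl rfl)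
    · exact (hoff (x, y) hxy).comp hc
  · refine continuous_iff_continuousAt.2 fun x => ?_
    have hc : ContinuousAt (fun x => (x, y)) x := by fun_prop
    by_cases hxy : x = y
    · subst hxy
      intro G hG
      simp only [hfd] at hG
      change ∀ᶠ w in 𝓝 x, _ ∈ G
      filter_upwards [hc.eventually (hcross x G hG)] with w hw using hw (Or.inr rfl)
    · exact (hoff (x, y) hxy).comp (f := fun x => (x, y)) hc

/-! ### Baire-one maps into `σ`-products -/

/-- The self-map of an equiconnected metric space that sends the ball of radius `1 / k` around `a`
to `a`, is the identity at distance at least `2 / k` from `a`, and pushes the points in between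
towards `a` along the paths given by `l`. -/
noncomputable def pushTo {Y : Type*} [MetricSpace Y] (l : Y × Y × unitInterval → Y) (a : Y)
    (k : ℕ) (u : Y) : Y :=
  l (a, u, Set.projIcc 0 1 zero_le_one (k * dist u a - 1))

theorem continuous_pushTo {Y : Type*} [MetricSpace Y] {l : Y × Y × unitInterval → Y}
    (hl : Continuous l) (a : Y) (k : ℕ) : Continuous (pushTo l a k) := by
  have : Continuous fun u => Set.projIcc (0 : ℝ) 1 zero_le_one (k * dist u a - 1) :=
    continuous_projIcc.comp (by fun_prop)
  unfold pushTo
  fun_prop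

theorem pushTo_of_le {Y : Type*} [MetricSpace Y] {l : Y × Y × unitInterval → Y}
    (h0 : ∀ x y, l (x, y, 0) = x) {a u : Y} {k : ℕ} (h : k * dist u a ≤ 1) :
    pushTo l a k u = a := by
  unfold pushTo
  rw [Set.projIcc_of_le_left _ (by linarith)]
  exact h0 _ _

theorem pushTo_of_ge {Y : Type*} [MetricSpace Y] {l : Y × Y × unitInterval → Y}
    (h1 : ∀ x y, l (y, x, 1) = x) {a u : Y} {k : ℕ} (h : 2 ≤ k * dist u a) :
    pushTo l a k u = u := by
  unfold pushTo
  rw [Set.projIcc_of_right_le _ (by linarith)]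
  exact h1 _ _

theorem tendsto_pushTo {Y : Type*} [MetricSpace Y] {l : Y × Y × unitInterval → Y}
    (hl : Continuous l) (h1 : ∀ x y, l (y, x, 1) = x) (hd : ∀ x t, l (x, x, t) = x) (a : Y)
    {u : ℕ → Y} {v : Y} (hu : Tendsto u atTop (𝓝 v)) :
    Tendsto (fun k => pushTo l a k (u k)) atTop (𝓝 v) := by
  rcases eq_or_ne v a with rfl | hva
  · intro G hG
    obtain ⟨A, hA, hvA, hAG⟩ := exists_nhds_equiconnecting_mem hl hd hG
    change ∀ᶠ k in atTop, _ ∈ G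
    filter_upwards [hu.eventually_mem (hA.mem_nhds hvA)] with k hk
    exact hAG _ hvA _ hk _
  · have hlim : Tendsto (fun k : ℕ => (k : ℝ) * dist (u k) a) atTop atTop :=
      tendsto_natCast_atTop_atTop.atTop_mul_pos (dist_pos.2 hva) (hu.dist tendsto_const_nhds)
    refine hu.congr' ?_
    filter_upwards [hlim.eventually_ge_atTop 2] with k hk
    exact (pushTo_of_ge h1 hk).symm

/-- Pushing the coordinates of the approximations towards `a` makes the support of `q k` at all
points near `x` a part of the support of the original approximation at `x`. This bounds the
supports that occur in the limit at the diagonal by one finite set. -/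
theorem BoxProduct.exists_separatelyContinuous_sigmaProduct {X S : Type*} {Z : S → Type*}
    [TopologicalSpace X] [TopologicalSpace.MetrizableSpace X] [∀ s, TopologicalSpace (Z s)]
    [∀ s, TopologicalSpace.MetrizableSpace (Z s)] (hZ : ∀ s, Equiconnected (Z s))
    {a : BoxProduct Z} {F : ℕ → X → sigmaProduct a} {g : X → sigmaProduct a}
    (hF : ∀ k, Continuous (F k)) (hFg : ∀ x, Tendsto (fun k => F k x) atTop (𝓝 (g x))) :
    ∃ f : X × X → sigmaProduct a, SeparatelyContinuous f ∧ ∀ x, f (x, x) = g x := by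
  let _ : ∀ s, MetricSpace (Z s) := fun s => TopologicalSpace.metrizableSpaceMetric (Z s)
  have hY := BoxProduct.equiconnected_sigmaProduct hZ a
  choose l hl h0 h1 hd using hZ
  have hpa : ∀ k s, pushTo (l s) (a s) k (a s) = a s := fun k s => pushTo_of_le (h0 s) (by simp)
  let q : ℕ → X → sigmaProduct a := fun k x =>
    ⟨fun s => pushTo (l s) (a s) k ((F k x).1 s), (F k x).2.subset fun s hs h => hs (by
      simp only [h, hpa])⟩
  have hFc : ∀ k x s, Tendsto (fun x' => (F k x').1 s) (𝓝 x) (𝓝 ((F k x).1 s)) := fun k x s =>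
    ((continuous_eval s).comp (continuous_subtype_val.comp (hF k))).tendsto x
  have hqc : ∀ k x s, Tendsto (fun x' => (q k x').1 s) (𝓝 x) (𝓝 ((q k x).1 s)) := fun k x s =>
    ((continuous_pushTo (hl s) (a s) k).tendsto _).comp (hFc k x s)
  have hFT : ∀ k x, ∃ T : Set S, T.Finite ∧ ∀ᶠ x' in 𝓝 x, ∀ s ∉ T, (F k x').1 s = (F k x).1 s :=
    fun k x => exists_finite_eventually_eq
      ((continuous_subtype_val.comp (hF k)).tendsto x)
  have hq : ∀ k, Continuous (q k) := by
    refine fun k => Continuous.subtype_mk (continuous_iff_continuousAt.2 fun x => ?_) _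
    obtain ⟨T, hT, hev⟩ := hFT k x
    refine tendsto_of_eventually_eq hT ?_ (hqc k x)
    filter_upwards [hev] with x' hx' s hs
    simp only [hx' s hs]
  let W : ℕ → Set (X × X) := fun k => {p | ∀ s,
    dist ((q k p.1).1 s) ((q k p.2).1 s) < 1 / ((k : ℝ) + 1) ∧
      ((F k p.2).1 s = a s → (q k p.1).1 s = a s)}
  have hWd : ∀ k x, W k ∈ 𝓝 (x, x) := by
    intro k x
    obtain ⟨T, hT, hev⟩ := hFT k x
    have hfst : Tendsto (Prod.fst : X × X → X) (𝓝 (x, x)) (𝓝 x) := continuous_fst.tendsto _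
    have hsnd : Tendsto (Prod.snd : X × X → X) (𝓝 (x, x)) (𝓝 x) := continuous_snd.tendsto _
    have hfin : ∀ᶠ p : X × X in 𝓝 (x, x), ∀ s ∈ T,
        dist ((q k p.1).1 s) ((q k p.2).1 s) < 1 / ((k : ℝ) + 1) ∧
          ((F k p.2).1 s = a s → (q k p.1).1 s = a s) := by
      refine (eventually_all_finite hT).2 fun s _ => Eventually.and ?_ ?_
      · have := ((hqc k x s).comp hfst).dist ((hqc k x s).comp hsnd)
        rw [dist_self] at this
        exact this.eventually_lt_const Nat.one_div_pos_of_nat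
      · by_cases hs : (F k x).1 s = a s
        · have hlim : Tendsto (fun x' => (k : ℝ) * dist ((F k x').1 s) (a s)) (𝓝 x) (𝓝 0) := by
            have := ((hFc k x s).dist (tendsto_const_nhds (x := a s))).const_mul (k : ℝ)
            simpa [hs] using this
          filter_upwards [hfst.eventually (hlim.eventually_lt_const one_pos)] with p hp _
          exact pushTo_of_le (h0 s) hp.le
        · filter_upwards [hsnd.eventually ((hFc k x s).eventually_ne hs)] with p hp h
          exact absurd h hp
    filter_upwards [hfst.eventually hev, hsnd.eventually hev, hfin] with p h₁ h₂ h₃ s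
    by_cases hs : s ∈ T
    · exact h₃ s hs
    · have e : (F k p.1).1 s = (F k p.2).1 s := (h₁ s hs).trans (h₂ s hs).symm
      refine ⟨?_, fun h => ?_⟩
      · simp only [q, e, dist_self]
        exact Nat.one_div_pos_of_nat
      · simp only [q, e, h, hpa]
  refine exists_separatelyContinuous_diagonal hY hq (W := fun k => interior (W k))
    (fun k => isOpen_interior) (fun k x => mem_interior_iff_mem_nhds.2 (hWd k x)) ?_
  intro y G hG
  let ℓ : Filter (ℕ × X) := comap Prod.fst atTop ⊓ 𝓟 {p | (p.2, y) ∈ W p.1}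
  have hfst : Tendsto (Prod.fst : ℕ × X → ℕ) ℓ atTop := tendsto_comap.mono_left inf_le_left
  have hmem : ∀ᶠ p in ℓ, (p.2, y) ∈ W p.1 := mem_inf_of_right (mem_principal_self _)
  have hlim : Tendsto (fun p : ℕ × X => q p.1 p.2) ℓ (𝓝 (g y)) := by
    have hval := (continuous_subtype_val.tendsto (g y)).comp (hFg y)
    obtain ⟨T, hT, hev⟩ := exists_finite_eventually_eq hval
    refine tendsto_subtype_rng.2 (tendsto_of_eventually_eq (hT.union (g y).2) ?_ fun s => ?_)
    · filter_upwards [hfst.eventually hev, hmem] with p h₁ h₂ s hs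
      simp only [Set.mem_union, Set.mem_ofPred_eq, not_or, not_not] at hs
      exact ((h₂ s).2 ((h₁ s hs.1).trans hs.2)).trans hs.2.symm
    · have hqy : Tendsto (fun k => (q k y).1 s) atTop (𝓝 ((g y).1 s)) :=
        tendsto_pushTo (hl s) (h1 s) (hd s) (a s) (((continuous_eval s).tendsto _).comp hval)
      refine tendsto_of_tendsto_of_dist (hqy.comp hfst) ?_
      refine squeeze_zero' (Eventually.of_forall fun _ => dist_nonneg) ?_
        (tendsto_one_div_add_atTop_nhds_zero_nat.comp hfst)
      filter_upwards [hmem] with p hp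
      rw [dist_comm]
      exact (hp s).1.le
  obtain ⟨t, ht, hsub⟩ := mem_comap.1 (mem_inf_principal.1 (hlim hG))
  obtain ⟨m, hm⟩ := mem_atTop_sets.1 ht
  exact ⟨m, fun k hk x hx => hsub (a := (k, x)) (hm k hk)
    (show (x, y) ∈ W k from interior_subset hx)⟩

theorem mainTheorem3 {X S : Type*} {Z : S → Type*}
    [TopologicalSpace X] [TopologicalSpace.MetrizableSpace X] [PreconnectedSpace X]
    (hX : StronglyCountablyDimensional X)
    [∀ s, TopologicalSpace (Z s)] [∀ s, TopologicalSpace.MetrizableSpace (Z s)]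
    (hZ : ∀ s, Equiconnected (Z s)) (g : X → BoxProduct Z) :
    IsBaireClass 1 g ↔
      ∃ f : X × X → BoxProduct Z, SeparatelyContinuous f ∧ ∀ x, f (x, x) = g x := by
  rcases isEmpty_or_nonempty X with hX' | ⟨⟨x₀⟩⟩
  · exact ⟨fun _ => ⟨fun p => g p.1, ⟨fun x => (hX'.false x).elim, fun x => (hX'.false x).elim⟩,
      fun _ => rfl⟩, fun _ => ⟨fun _ => g, fun _ => continuous_of_discreteTopology,
      fun x => (hX'.false x).elim⟩⟩
  constructor
  · rintro ⟨F, hF, hFg⟩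
    have hFc : ∀ k, Continuous (F k) := hF
    -- From some index on, all values of `F k` lie in the `σ`-product around `g x₀`.
    obtain ⟨T, hT, hev⟩ := BoxProduct.exists_finite_eventually_eq (hFg x₀)
    obtain ⟨N, hN⟩ := eventually_atTop.1 hev
    have hFσ : ∀ k x, F (k + N) x ∈ BoxProduct.sigmaProduct (g x₀) := by
      intro k x
      refine ((BoxProduct.finite_ne_of_continuous (hFc (k + N)) x x₀).union hT).subset ?_
      intro s hs
      by_contra h
      simp only [Set.mem_union, Set.mem_ofPred_eq, not_or, not_not] at h
      exact hs (h.1.trans (hN _ (Nat.le_add_left _ _) s h.2))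
    have hFg' : ∀ x, Tendsto (fun k => F (k + N) x) atTop (𝓝 (g x)) := fun x =>
      (hFg x).comp (tendsto_add_atTop_nat N)
    have hgσ : ∀ x, g x ∈ BoxProduct.sigmaProduct (g x₀) := by
      intro x
      obtain ⟨T', hT', hev'⟩ := BoxProduct.exists_finite_eventually_eq (hFg' x)
      obtain ⟨k, hk⟩ := hev'.exists
      refine (Set.Finite.union (hFσ k x) hT').subset fun s hs => ?_
      by_contra h
      simp only [Set.mem_union, Set.mem_ofPred_eq, not_or, not_not] at h
      exact hs ((hk s h.2).symm.trans h.1)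
    obtain ⟨f, hf, hfg⟩ := BoxProduct.exists_separatelyContinuous_sigmaProduct hZ
      (F := fun k x => ⟨F (k + N) x, hFσ k x⟩) (g := fun x => ⟨g x, hgσ x⟩)
      (fun k => (hFc (k + N)).subtype_mk _) fun x => tendsto_subtype_rng.2 (hFg' x)
    exact ⟨fun p => f p, ⟨fun x => continuous_subtype_val.comp (hf.1 x),
      fun y => continuous_subtype_val.comp (hf.2 y)⟩, fun x => congrArg Subtype.val (hfg x)⟩
  · rintro ⟨f, hf, hfg⟩
    have hσ : ∀ p, f p ∈ BoxProduct.sigmaProduct (f (x₀, x₀)) := by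
      rintro ⟨x, y⟩
      refine ((BoxProduct.finite_ne_of_continuous (hf.1 x) y x₀).union
        (BoxProduct.finite_ne_of_continuous (hf.2 x₀) x x₀)).subset fun s hs => ?_
      by_contra h
      simp only [Set.mem_union, Set.mem_ofPred_eq, not_or, not_not] at h
      exact hs (h.1.trans h.2)
    obtain ⟨F, hF, hFg⟩ := SeparatelyContinuous.isBaireClass_one_diagonal
      (BoxProduct.equiconnected_sigmaProduct hZ (f (x₀, x₀)))
      (f := fun p => ⟨f p, hσ p⟩) ⟨fun x => (hf.1 x).subtype_mk _, fun y => (hf.2 y).subtype_mk _⟩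
    refine ⟨fun k x => F k x, fun k => continuous_subtype_val.comp (hF k), fun x => ?_⟩
    rw [← hfg x]
    exact tendsto_subtype_rng.1 (hFg x)
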